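/- Let $n\ge 2$, let $\bar B^n\subset\mathbb R^n$ be the closed unit ball, and let $E\subset S^{n-1}=\partial B^n$ be nonempty and open in $S^{n-1}$. A broken ray is a curve $\gamma:[0,L]\to\bar B^n$ of finite length, parametrized by arc length, consisting of finitely many (at least one) nondegenerate chords joining points of $S^{n-1}$, with both endpoints in $E$, and satisfying the reflection law $v_o=v_i-2\langle\nu,v_i\rangle\nu$ ($\nu$ the outer unit normal) at each intermediate vertex (which may lie in $E$ or not). The broken ray transform of a continuous $f:\bar B^n\to\mathbb C$ is $\mathcal Gf(\gamma)=\int_0^Lf(\gamma(t))\,dt$, defined for all broken rays $\gamma$. For a sequence $M=(M_l)_{l\ge 0}$ of positive numbers, the Denjoy–Carleman class $C\{M\}$ consists of the smooth $2\pi$-periodic functions $h:\mathbb R\to\mathbb C$ for which there are constants $C,B>0$ with $|h^{(l)}|\le CB^lM_l$ for all $l\ge0$. The sequence $M$ is quasianalytic if every $h\in C\{M\}$, all of whose derivatives ($l\ge 0$) vanish at some point, is identically zero. For orthonormal $u,v\in\mathbb R^n$ write $f_{u,v}(r,\theta)=f(r\cos\theta\,u+r\sin\theta\,v)$, $0\le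 r\le1$. We say that $f$ is uniformly quasianalytic in the angular variable, with respect to a family $(M^{u,v})$ of quasianalytic sequences, if for every orthonormal pair $u,v$ all functions $f_{u,v}(r,\cdot)$, $0\le r\le 1$, belong to $C\{M^{u,v}\}$ with constants $C,B$ independent of $r$. The angular derivatives of $f$ of all orders satisfy the Dini–Lipschitz condition if for every orthonormal pair $u,v$ and every $l\ge0$, $$\lim_{\delta\to0+}\ \log(1/\delta)\,\sup_{0\le r\le1}\ \sup_{|\theta-\theta'|\le\delta}\bigl|\partial_\theta^lf_{u,v}(r,\theta)-\partial_\theta^lf_{u,v}(r,\theta')\bigr|=0 .$$ Theorem. Let $f,g:\bar B^n\to\mathbb C$ be continuous and uniformly quasianalytic in the angular variable with respect to the same family of quasianalytic sequences, and suppose that the angular derivatives of all orders of $f$ and of $g$ satisfy the Dini–Lipschitz condition. If $\mathcal Gf=\mathcal Gg$, then $f=g$ on $\bar B^n$. -/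

import Mathlib

open Real Set Filter Topology
open scoped ENNReal ContDiff

noncomputable section

/-- `direction p q` is the unit vector pointing from `p` to `q` (for `p ≠ q`). -/
def direction {n : ℕ} (p q : EuclideanSpace ℝ (Fin n)) : EuclideanSpace ℝ (Fin n) :=
  ‖q - p‖⁻¹ • (q - p)

/-- A broken ray in the closed unit ball of `ℝⁿ` with set of tomography `E ⊆ Sⁿ⁻¹`: a curve of
finite length, made of `N ≥ 1` straight segments (chords) joining consecutive vertices on the
sphere, which starts and ends in `E` and obeys the law of reflection
`v_out = v_in - 2 ⟪ν, v_in⟫ ν` at every intermediate vertex. The outer unit normal `ν` at a point of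
the unit sphere is the point itself. Reflections at points of `E` are allowed.
Only the vertices `0, …, N` matter. -/
structure BrokenRay {n : ℕ} (E : Set (Metric.sphere (0 : EuclideanSpace ℝ (Fin n)) 1)) where
  /-- number of segments -/
  N : ℕ
  N_pos : 0 < N
  /-- endpoints of the segments -/
  vertex : ℕ → Metric.sphere (0 : EuclideanSpace ℝ (Fin n)) 1
  start_mem : vertex 0 ∈ E
  end_mem : vertex N ∈ E
  vertex_ne : ∀ j < N, vertex j ≠ vertex (j + 1)
  reflection : ∀ j, j + 1 < N →
    direction (vertex (j + 1) : EuclideanSpace ℝ (Fin n)) (vertex (j + 2)) =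
      direction (vertex j : EuclideanSpace ℝ (Fin n)) (vertex (j + 1)) -
        (2 * inner ℝ (vertex (j + 1) : EuclideanSpace ℝ (Fin n))
          (direction (vertex j : EuclideanSpace ℝ (Fin n)) (vertex (j + 1)))) •
          (vertex (j + 1) : EuclideanSpace ℝ (Fin n))

/-- The broken ray transform of `f`: the integral of `f` with respect to arc length over each
broken ray, that is, the sum over its segments of the integrals of `f` along the unit speed
parametrization of the segment. -/
def brokenRayTransform {n : ℕ} (E : Set (Metric.sphere (0 : EuclideanSpace ℝ (Fin n)) 1))
    (f : EuclideanSpace ℝ (Fin n) → ℂ) : BrokenRay E → ℂ := fun γ =>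
  ∑ j ∈ Finset.range γ.N,
    ∫ s in (0 : ℝ)..‖(γ.vertex (j + 1) : EuclideanSpace ℝ (Fin n)) - γ.vertex j‖,
      f ((γ.vertex j : EuclideanSpace ℝ (Fin n)) +
        s • direction (γ.vertex j : EuclideanSpace ℝ (Fin n)) (γ.vertex (j + 1)))

/-- The Denjoy–Carleman class of the circle with weights `M`, with constants `C` and `B`: smooth
`2π`-periodic functions whose `l`-th derivative is bounded by `C * B ^ l * M l` for every `l`. -/
def InDenjoyCarleman (M : ℕ → ℝ) (C B : ℝ) (h : ℝ → ℂ) : Prop :=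
  ContDiff ℝ ∞ h ∧ Function.Periodic h (2 * π) ∧
    ∀ (l : ℕ) (t : ℝ), ‖iteratedDeriv l h t‖ ≤ C * B ^ l * M l

/-- A sequence `M` of positive numbers is quasianalytic if the only function in its
Denjoy–Carleman class on the circle which vanishes with all its derivatives at some point is the
zero function. -/
def IsQuasianalytic (M : ℕ → ℝ) : Prop :=
  (∀ l, 0 < M l) ∧
    ∀ (C B : ℝ) (h : ℝ → ℂ), 0 < C → 0 < B → InDenjoyCarleman M C B h →
      ∀ t₀ : ℝ, (∀ l : ℕ, iteratedDeriv l h t₀ = 0) → ∀ t, h t = 0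

/-- The function `f` in polar coordinates `(r, θ)` of the plane with orthonormal basis `u, v`, as
a function of the angular variable `θ` on the circle of radius `r`. -/
def angularProfile {n : ℕ} (f : EuclideanSpace ℝ (Fin n) → ℂ) (u v : EuclideanSpace ℝ (Fin n))
    (r : ℝ) : ℝ → ℂ := fun θ => f (r • (cos θ • u + sin θ • v))

/-- `f` is uniformly quasianalytic in the angular variable on the unit disc of the plane with
orthonormal basis `u, v`, with respect to the sequence `M`: the sequence is quasianalytic and the
restrictions of `f` to the circles of radius `r ∈ [0, 1]` belong to its Denjoy–Carleman class with
constants that do not depend on `r`. -/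
def UniformlyQuasianalytic {n : ℕ} (M : ℕ → ℝ) (f : EuclideanSpace ℝ (Fin n) → ℂ)
    (u v : EuclideanSpace ℝ (Fin n)) : Prop :=
  IsQuasianalytic M ∧ ∃ C B : ℝ, 0 < C ∧ 0 < B ∧
    ∀ r ∈ Icc (0 : ℝ) 1, InDenjoyCarleman M C B (angularProfile f u v r)

/-- The modulus of continuity, in the angular variable and uniformly in the radius, of the `l`-th
angular derivative of `f` on the unit disc of the plane with orthonormal basis `u, v`. -/
def angularModulus {n : ℕ} (f : EuclideanSpace ℝ (Fin n) → ℂ) (u v : EuclideanSpace ℝ (Fin n))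
    (l : ℕ) (δ : ℝ) : ℝ≥0∞ :=
  ⨆ (r : ℝ) (_ : r ∈ Icc (0 : ℝ) 1) (θ : ℝ) (θ' : ℝ) (_ : |θ - θ'| ≤ δ),
    ‖iteratedDeriv l (angularProfile f u v r) θ - iteratedDeriv l (angularProfile f u v r) θ'‖ₑ

/-- The `l`-th angular derivative of `f` on the unit disc of the plane with orthonormal basis
`u, v` satisfies the Dini–Lipschitz condition `ω(δ) log (1 / δ) → 0` as `δ → 0+`. -/
def AngularDiniLipschitz {n : ℕ} (f : EuclideanSpace ℝ (Fin n) → ℂ)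
    (u v : EuclideanSpace ℝ (Fin n)) (l : ℕ) : Prop :=
  Tendsto (fun δ : ℝ => angularModulus f u v l δ * ENNReal.ofReal (log (1 / δ)))
    (𝓝[>] 0) (𝓝 0)

end

/-! The problem is planar. Every point lies in a plane through the origin and a chosen `e ∈ E`, and
in that plane the chords of a broken ray all lie at one distance `z = cos a` from the origin, each
rotated by `2a` from the one before. With `R θ` the integral of `f - g` over the chord at distance
`z` whose normal has angle `θ + a`, equality of the transforms says that `∑_{j<N} R (θ + 2ja) = 0`
whenever both endpoints lie in `E`.

Let `a / π` be irrational. Some `N` brings `2Na` close to `0` modulo `2π`, so the sum vanishes for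
all `θ` near `0`. Differentiation under the integral puts `R`, hence the sum, in the quasianalytic
class, so the sum vanishes for every `θ`. Subtracting it from its translate by `2a` shows that `R`
has period `2Na` as well as `2π`; it is therefore constant, and the constant is `0`
(`eq_zero_of_orbit_sum_eq_zero`).

Thus all chord integrals vanish for almost every `z`. By the Fourier slice argument `f - g`,
restricted to the disc and extended by zero, has zero Fourier transform, and Fourier inversion
finishes the proof (`eqOn_zero_of_chordIntegral_eq_zero`). -/

open MeasureTheory

/-! ### Closure properties of Denjoy–Carleman classes -/

namespace InDenjoyCarleman

variable {M : ℕ → ℝ} {C C' B B' : ℝ} {h k : ℝ → ℂ}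

theorem continuous (hh : InDenjoyCarleman M C B h) : Continuous h := hh.1.continuous

theorem comp_add_const (hh : InDenjoyCarleman M C B h) (a : ℝ) :
    InDenjoyCarleman M C B fun t => h (t + a) := by
  refine ⟨hh.1.comp (contDiff_id.add contDiff_const), fun t => ?_, fun l t => ?_⟩
  · have := hh.2.1 (t + a)
    rwa [add_right_comm] at this
  · rw [iteratedDeriv_comp_add_const]
    exact hh.2.2 l (t + a)

theorem neg (hh : InDenjoyCarleman M C B h) : InDenjoyCarleman M C B (-h) := by
  refine ⟨hh.1.neg, fun t => by simp [hh.2.1 t], fun l t => ?_⟩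
  rw [iteratedDeriv_neg, norm_neg]
  exact hh.2.2 l t

theorem add (hM : ∀ l, 0 < M l) (hC : 0 ≤ C) (hC' : 0 ≤ C') (hB : 0 ≤ B) (hB' : 0 ≤ B')
    (hh : InDenjoyCarleman M C B h) (hk : InDenjoyCarleman M C' B' k) :
    InDenjoyCarleman M (C + C') (max B B') (h + k) := by
  refine ⟨hh.1.add hk.1, hh.2.1.add hk.2.1, fun l t => ?_⟩
  have hle : (l : WithTop ℕ∞) ≤ (⊤ : ℕ∞) := by exact_mod_cast le_top
  rw [iteratedDeriv_add (hh.1.of_le hle).contDiffAt (hk.1.of_le hle).contDiffAt]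
  calc _ ≤ C * B ^ l * M l + C' * B' ^ l * M l :=
        (norm_add_le _ _).trans (add_le_add (hh.2.2 l t) (hk.2.2 l t))
    _ ≤ C * max B B' ^ l * M l + C' * max B B' ^ l * M l := by
        have := (hM l).le
        gcongr
        · exact le_max_left _ _
        · exact le_max_right _ _
    _ = _ := by ring

theorem sub (hM : ∀ l, 0 < M l) (hC : 0 ≤ C) (hC' : 0 ≤ C') (hB : 0 ≤ B) (hB' : 0 ≤ B')
    (hh : InDenjoyCarleman M C B h) (hk : InDenjoyCarleman M C' B' k) :
    InDenjoyCarleman M (C + C') (max B B') (h - k) := by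
  rw [sub_eq_add_neg]
  exact add hM hC hC' hB hB' hh hk.neg

theorem sum {ι : Type*} {h : ι → ℝ → ℂ} (s : Finset ι)
    (hh : ∀ i ∈ s, InDenjoyCarleman M C B (h i)) :
    InDenjoyCarleman M (s.card * C) B fun t => ∑ i ∈ s, h i t := by
  refine ⟨ContDiff.sum fun i hi => (hh i hi).1,
    fun t => Finset.sum_congr rfl fun i hi => (hh i hi).2.1 t, fun l t => ?_⟩
  have hle : (l : WithTop ℕ∞) ≤ (⊤ : ℕ∞) := by exact_mod_cast le_top
  rw [iteratedDeriv_fun_sum fun i hi => ((hh i hi).1.of_le hle).contDiffAt]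
  calc _ ≤ ∑ i ∈ s, C * B ^ l * M l := norm_sum_le_of_le _ fun i hi => (hh i hi).2.2 l t
    _ = _ := by rw [Finset.sum_const, nsmul_eq_mul]; ring

/-- Denjoy–Carleman classes are stable under integration with respect to a parameter. -/
theorem integral {T : Type*} [MeasurableSpace T] {μ : Measure T} [IsFiniteMeasure μ]
    {K : T → ℝ → ℂ} (hmeas : ∀ θ, AEStronglyMeasurable (fun t => K t θ) μ)
    (hK : ∀ᵐ t ∂μ, InDenjoyCarleman M C B (K t)) :
    InDenjoyCarleman M (C * μ.real univ) B fun θ => ∫ t, K t θ ∂μ := by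
  have hderiv : ∀ (l : ℕ), ∀ᵐ t ∂μ, ∀ θ,
      HasDerivAt (iteratedDeriv l (K t)) (iteratedDeriv (l + 1) (K t) θ) θ := fun l => by
    filter_upwards [hK] with t ht θ
    rw [iteratedDeriv_succ]
    exact (ht.1.differentiable_iteratedDeriv l
      (by exact_mod_cast WithTop.coe_lt_top l) θ).hasDerivAt
  have hmeas' : ∀ (l : ℕ) θ, AEStronglyMeasurable (fun t => iteratedDeriv l (K t) θ) μ := by
    intro l
    induction l with
    | zero => simpa using hmeas
    | succ l ih =>
      intro θ
      -- Measurability in `t` is assumed for `K` only; derivatives inherit it as limits of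
      -- difference quotients.
      refine aestronglyMeasurable_of_tendsto_ae (𝓝[≠] θ)
        (f := fun x t => slope (iteratedDeriv l (K t)) θ x) (fun x => ?_) ?_
      · simp only [slope_def_module]
        exact ((ih x).sub (ih θ)).const_smul _
      · filter_upwards [hderiv l] with t ht using (ht θ).tendsto_slope
  have hbound : ∀ (l : ℕ), ∀ᵐ t ∂μ, ∀ θ, ‖iteratedDeriv l (K t) θ‖ ≤ C * B ^ l * M l := fun l => by
    filter_upwards [hK] with t ht θ using ht.2.2 l θ
  have hstep : ∀ (l : ℕ) θ, HasDerivAt (fun θ => ∫ t, iteratedDeriv l (K t) θ ∂μ)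
      (∫ t, iteratedDeriv (l + 1) (K t) θ ∂μ) θ := fun l θ =>
    (hasDerivAt_integral_of_dominated_loc_of_deriv_le (s := univ)
      (bound := fun _ => C * B ^ (l + 1) * M (l + 1)) univ_mem
      (Eventually.of_forall fun x => hmeas' l x)
      (Integrable.of_bound (hmeas' l θ) (C * B ^ l * M l)
        ((hbound l).mono fun t ht => ht θ))
      (hmeas' (l + 1) θ) ((hbound (l + 1)).mono fun t ht x _ => ht x) (integrable_const _)
      ((hderiv l).mono fun t ht x _ => ht x)).2
  have hiter : ∀ l : ℕ, iteratedDeriv l (fun θ => ∫ t, K t θ ∂μ) =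
      fun θ => ∫ t, iteratedDeriv l (K t) θ ∂μ := by
    intro l
    induction l with
    | zero => simp
    | succ l ih =>
      rw [iteratedDeriv_succ, ih]
      exact funext fun θ => (hstep l θ).deriv
  refine ⟨contDiff_of_differentiable_iteratedDeriv fun m _ => ?_, fun θ => ?_, fun l θ => ?_⟩
  · rw [hiter]
    exact fun θ => (hstep m θ).differentiableAt
  · refine integral_congr_ae ?_
    filter_upwards [hK] with t ht using ht.2.1 θ
  · rw [hiter]
    refine (norm_integral_le_of_norm_le_const ((hbound l).mono fun t ht => ht θ)).trans_eq ?_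
    ring

end InDenjoyCarleman

/-! ### Orbit sums of an irrational rotation -/

/-- A continuous function on the line with two incommensurable periods is constant. -/
theorem eq_of_periodic_of_periodic_of_irrational {X : Type*} [TopologicalSpace X] [T2Space X]
    {R : ℝ → X} (hR : Continuous R) {a b : ℝ} (ha : Function.Periodic R a)
    (hb : Function.Periodic R b) (hab : Irrational (a / b)) (x : ℝ) : R x = R 0 := by
  have hd := dense_addSubgroupClosure_pair_iff.2 hab
  refine congrFun (hR.ext_on hd continuous_const fun y hy => ?_) x
  have key : ∀ y ∈ AddSubgroup.closure {a, b}, Function.Periodic R y := by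
    intro y hy
    induction hy using AddSubgroup.closure_induction with
    | mem z hz => rcases hz with rfl | rfl <;> assumption
    | zero => intro x; simp
    | add u v _ _ hu hv => exact hu.add_period hv
    | neg u _ hu => exact hu.neg
  simpa using key y hy 0

/-- If the sums of a function in a quasianalytic class over finite orbit segments of an irrational
rotation vanish whenever the segment starts and ends near `0`, then the function vanishes. -/
theorem InDenjoyCarleman.eq_zero_of_orbit_sum_eq_zero {M : ℕ → ℝ} (hM : IsQuasianalytic M)
    {C B : ℝ} (hC : 0 < C) (hB : 0 < B) {R : ℝ → ℂ} (hR : InDenjoyCarleman M C B R)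
    {α : ℝ} (hα : Irrational (α / (2 * π))) {A : Set ℝ} (hA : A ∈ 𝓝 (0 : ℝ))
    (hAper : ∀ x ∈ A, ∀ k : ℤ, x + k * (2 * π) ∈ A)
    (hsum : ∀ N : ℕ, 0 < N → ∀ θ ∈ A, θ + N * α ∈ A →
      ∑ j ∈ Finset.range N, R (θ + j * α) = 0) (θ : ℝ) : R θ = 0 := by
  obtain ⟨ε, hε, hεA⟩ := Metric.mem_nhds_iff.1 hA
  -- Chosen so that Dirichlet's error `1 / (n + 1)`, scaled by `2π`, is below `ε / 2`; the other
  -- half of `ε` is the range left for the starting angle.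
  obtain ⟨n, hn⟩ := exists_nat_gt (2 * (2 * π) / ε)
  have hπ : 0 < 2 * π := by positivity
  have hn0 : 0 < n := by
    have : (0 : ℝ) < n := lt_trans (by positivity) hn
    exact_mod_cast this
  obtain ⟨N, hN, -, hNle⟩ := Real.exists_nat_abs_mul_sub_round_le (α / (2 * π)) hn0
  set m := round ((N : ℝ) * (α / (2 * π)))
  have hclose : |N * α - m * (2 * π)| < ε / 2 := by
    have h1 : N * α - m * (2 * π) = (N * (α / (2 * π)) - m) * (2 * π) := by field_simp
    rw [h1, abs_mul, abs_of_pos hπ]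
    calc _ ≤ 1 / (n + 1 : ℝ) * (2 * π) := by gcongr
      _ < ε / 2 := by
        rw [div_lt_iff₀ hε] at hn
        rw [one_div_mul_eq_div, div_lt_div_iff₀ (by positivity) two_pos]
        nlinarith
  have hS : ∀ θ, ∑ j ∈ Finset.range N, R (θ + j * α) = 0 := by
    have hdc := InDenjoyCarleman.sum (Finset.range N) (h := fun (j : ℕ) t => R (t + j * α))
      fun j _ => hR.comp_add_const (j * α)
    refine hM.2 _ B _ ?_ hB hdc 0 fun l => ?_
    · rw [Finset.card_range]
      positivity
    · have hev : (fun t => ∑ j ∈ Finset.range N, R (t + j * α)) =ᶠ[𝓝 0] fun _ => 0 := by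
        filter_upwards [Metric.ball_mem_nhds (0 : ℝ) (half_pos hε)] with t ht
        rw [mem_ball_zero_iff, Real.norm_eq_abs] at ht
        refine hsum N hN t (hεA ?_) ?_
        · rw [mem_ball_zero_iff, Real.norm_eq_abs]
          linarith
        · have h2 : t + (N * α - m * (2 * π)) ∈ A := by
            refine hεA ?_
            rw [mem_ball_zero_iff, Real.norm_eq_abs]
            linarith [abs_add_le t (N * α - m * (2 * π))]
          have := hAper _ h2 m
          rwa [add_assoc, sub_add_cancel] at this
      rw [hev.iteratedDeriv_eq]
      simp
  -- The sums starting at `x` and at `x + α` share all but their extreme terms `R x` and `R (x + N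
  -- α)`.
  have hper : Function.Periodic R (N * α) := fun x => by
    have h1 := hS x
    have h2 := hS (x + α)
    have h3 := Finset.sum_range_succ (fun j : ℕ => R (x + j * α)) N
    rw [Finset.sum_range_succ'] at h3
    have h4 : ∀ j : ℕ, x + ((j + 1 : ℕ) : ℝ) * α = x + α + j * α := fun j => by push_cast; ring
    simp only [h4, h1, h2] at h3
    simpa using h3.symm
  have hconst : ∀ x, R x = R 0 := eq_of_periodic_of_periodic_of_irrational hR.continuous hper
    hR.2.1 (by rw [mul_div_assoc]; exact hα.natCast_mul hN.ne')
  have h0 := hS 0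
  simp only [hconst (0 + _), Finset.sum_const, Finset.card_range, nsmul_eq_mul, mul_eq_zero,
    Nat.cast_eq_zero, hN.ne', false_or] at h0
  rw [hconst, h0]

/-! ### Injectivity of the chord transform on the disc -/

/-- The integral of `H` over the chord of the unit disc at signed distance `z` from the origin
whose normal has direction `exp (θ * I)`. -/
noncomputable def chordIntegral (H : ℂ → ℂ) (z θ : ℝ) : ℂ :=
  ∫ t in (-√(1 - z ^ 2))..√(1 - z ^ 2), H (Complex.exp (θ * Complex.I) * (z + t * Complex.I))

theorem norm_add_mul_I_le_one {z t : ℝ} :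
    ‖(z + t * Complex.I : ℂ)‖ ≤ 1 ↔ z ^ 2 + t ^ 2 ≤ 1 := by
  rw [← sq_le_one_iff₀ (norm_nonneg _), Complex.sq_norm, Complex.normSq_add_mul_I]

/-- The Fourier transform of a function supported in the closed unit disc all of whose chord
integrals vanish is zero. -/
theorem fourier_indicator_eq_zero_of_chordIntegral_eq_zero {H : ℂ → ℂ}
    (hint : Integrable ((Metric.closedBall 0 1).indicator H))
    (hH : ∀ᵐ z : ℝ, z ∈ Ioo (-1 : ℝ) 1 → ∀ θ, chordIntegral H z θ = 0) (ξ : ℂ) :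
    FourierTransform.fourier ((Metric.closedBall 0 1).indicator H) ξ = 0 := by
  set G := (Metric.closedBall (0 : ℂ) 1).indicator H with hG
  -- Rotating `ξ` to the positive real axis makes the phase depend on `re w` alone, so by Fubini the
  -- inner integral runs along a chord.
  set θ := Complex.arg ξ
  set ρ : ℂ ≃ₗᵢ[ℝ] ℂ := rotation (Circle.exp θ) with hρ
  have hρa : ∀ w, ρ w = Complex.exp (θ * Complex.I) * w := fun w => by
    rw [hρ, rotation_apply, Circle.coe_exp]
  have hinner : ∀ w, inner ℝ (ρ w) ξ = w.re * ‖ξ‖ := fun w => by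
    have hξ : ξ = ρ (‖ξ‖ : ℂ) := by
      rw [hρa, mul_comm]; exact (Complex.norm_mul_exp_arg_mul_I ξ).symm
    conv_lhs => rw [hξ]
    rw [LinearIsometryEquiv.inner_map_map, Complex.inner]
    simp [mul_comm]
  have hρm : MeasurePreserving ρ := ρ.measurePreserving
  have hρe : MeasurableEmbedding ρ := ρ.toHomeomorph.measurableEmbedding
  have he := Complex.volume_preserving_equiv_real_prod.symm
  have hint' : Integrable fun w : ℂ => Real.fourierChar (-(w.re * ‖ξ‖)) • G (ρ w) := by
    have h1 := hρm.integrable_comp_of_integrable ((Real.fourierIntegral_convergent_iff ξ).2 hint)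
    simpa only [Function.comp_def, hinner] using h1
  rw [Real.fourier_eq, ← hρm.integral_comp hρe]
  simp only [hinner]
  rw [← he.integral_comp Complex.measurableEquivRealProd.symm.measurableEmbedding]
  rw [Measure.volume_eq_prod, integral_prod]
  swap
  · exact (he.integrable_comp_emb Complex.measurableEquivRealProd.symm.measurableEmbedding).2 hint'
  refine integral_eq_zero_of_ae ?_
  -- The tangent lines `z = ±1`, about which `hH` says nothing, are discarded as a null set.
  have hne : ∀ a : ℝ, ∀ᵐ z : ℝ, z ≠ a := fun a => by
    simp [ae_iff]
  filter_upwards [hH, hne 1, hne (-1)] with z hz hz1 hz2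
  simp only [Complex.measurableEquivRealProd_symm_apply, Pi.zero_apply]
  simp only [Circle.smul_def]
  rw [integral_smul]
  suffices h : ∫ y : ℝ, G (ρ ⟨z, y⟩) = 0 by rw [h, smul_zero]
  have hmem : ∀ y : ℝ, ρ ⟨z, y⟩ ∈ Metric.closedBall (0 : ℂ) 1 ↔ z ^ 2 + y ^ 2 ≤ 1 := fun y => by
    rw [mem_closedBall_zero_iff, ρ.norm_map, Complex.mk_eq_add_mul_I, norm_add_mul_I_le_one]
  by_cases hz0 : z ∈ Ioo (-1 : ℝ) 1
  · rw [← hz hz0 θ, chordIntegral, intervalIntegral.integral_of_le (by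
      linarith [Real.sqrt_nonneg (1 - z ^ 2)]), ← integral_Icc_eq_integral_Ioc,
      ← integral_indicator measurableSet_Icc]
    refine integral_congr_ae (ae_of_all _ fun y => ?_)
    have hiff : ρ ⟨z, y⟩ ∈ Metric.closedBall (0 : ℂ) 1 ↔
        y ∈ Icc (-√(1 - z ^ 2)) √(1 - z ^ 2) := by
      have : 0 ≤ 1 - z ^ 2 := by nlinarith [hz0.1, hz0.2]
      rw [hmem, mem_Icc, ← abs_le, Real.le_sqrt (abs_nonneg y), sq_abs]
      · constructor <;> intro h <;> linarith
      · exact this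
    simp only [hG, indicator, hiff]
    split_ifs
    · rw [hρa, Complex.mk_eq_add_mul_I]
    · rfl
  · refine integral_eq_zero_of_ae (ae_of_all _ fun y => indicator_of_notMem ?_ _)
    rw [hmem]
    have h1 : 1 < z ^ 2 := by
      rcases lt_or_ge z 1 with h | h
      · have : z < -1 := lt_of_le_of_ne (not_lt.1 fun h' => hz0 ⟨h', h⟩) hz2
        nlinarith
      · have := lt_of_le_of_ne h hz1.symm
        nlinarith
    nlinarith [sq_nonneg y]

/-- A continuous function on the closed unit disc vanishes if its integrals over almost all chords
do. -/
theorem eqOn_zero_of_chordIntegral_eq_zero {H : ℂ → ℂ}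
    (hc : ContinuousOn H (Metric.closedBall 0 1))
    (hH : ∀ᵐ z : ℝ, z ∈ Ioo (-1 : ℝ) 1 → ∀ θ, chordIntegral H z θ = 0) :
    EqOn H 0 (Metric.closedBall 0 1) := by
  have hint : Integrable ((Metric.closedBall (0 : ℂ) 1).indicator H) :=
    (hc.integrableOn_compact (isCompact_closedBall 0 1)).integrable_indicator
      Metric.isClosed_closedBall.measurableSet
  have hF : FourierTransform.fourier ((Metric.closedBall (0 : ℂ) 1).indicator H) = 0 :=
    funext fun ξ => fourier_indicator_eq_zero_of_chordIntegral_eq_zero hint hH ξ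
  have hball : EqOn H 0 (Metric.ball 0 1) := fun w hw => by
    have hnhds : Metric.closedBall (0 : ℂ) 1 ∈ 𝓝 w :=
      mem_of_superset (Metric.isOpen_ball.mem_nhds hw) Metric.ball_subset_closedBall
    have hcont : ContinuousAt ((Metric.closedBall (0 : ℂ) 1).indicator H) w :=
      (hc.continuousAt hnhds).congr
        (eventuallyEq_of_mem hnhds fun y hy => (indicator_of_mem hy H).symm)
    have h := hint.fourierInv_fourier_eq (by rw [hF]; exact integrable_zero _ _ _) hcont
    rw [hF, indicator_of_mem (Metric.ball_subset_closedBall hw), Real.fourierInv_eq] at h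
    simpa using h.symm
  exact hball.of_subset_closure hc continuousOn_const Metric.ball_subset_closedBall
    (closure_ball (0 : ℂ) one_ne_zero).ge

theorem exp_mul_add_mul_I_mem_closedBall {z t : ℝ} (hz : z ∈ Ioo (-1 : ℝ) 1)
    (ht : t ∈ Icc (-√(1 - z ^ 2)) √(1 - z ^ 2)) (θ : ℝ) :
    Complex.exp (θ * Complex.I) * (z + t * Complex.I) ∈ Metric.closedBall (0 : ℂ) 1 := by
  rw [mem_closedBall_zero_iff, norm_mul, Complex.norm_exp_ofReal_mul_I, one_mul,
    norm_add_mul_I_le_one]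
  have := (sq_le_sq₀ (abs_nonneg t) (Real.sqrt_nonneg _)).2 (abs_le.2 ht)
  rw [sq_abs, Real.sq_sqrt (by nlinarith [hz.1, hz.2])] at this
  linarith

theorem continuousOn_chord {H : ℂ → ℂ} (hc : ContinuousOn H (Metric.closedBall 0 1)) {z : ℝ}
    (hz : z ∈ Ioo (-1 : ℝ) 1) (θ : ℝ) :
    ContinuousOn (fun t : ℝ => H (Complex.exp (θ * Complex.I) * (z + t * Complex.I)))
      (Icc (-√(1 - z ^ 2)) √(1 - z ^ 2)) :=
  hc.comp (by fun_prop) fun _ ht => exp_mul_add_mul_I_mem_closedBall hz ht θ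

theorem chordIntegral_sub {H K : ℂ → ℂ} (hH : ContinuousOn H (Metric.closedBall 0 1))
    (hK : ContinuousOn K (Metric.closedBall 0 1)) {z : ℝ} (hz : z ∈ Ioo (-1 : ℝ) 1) (θ : ℝ) :
    chordIntegral (H - K) z θ = chordIntegral H z θ - chordIntegral K z θ := by
  have hle : -√(1 - z ^ 2) ≤ √(1 - z ^ 2) := by linarith [Real.sqrt_nonneg (1 - z ^ 2)]
  exact intervalIntegral.integral_sub
    ((continuousOn_chord hH hz θ).intervalIntegrable_of_Icc hle)
    ((continuousOn_chord hK hz θ).intervalIntegrable_of_Icc hle)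

/-! ### Quasianalyticity of chord integrals and broken rays in the disc -/

/-- The integrals over the chords at a given distance from the origin of a function which is
uniformly quasianalytic in the angular variable form a quasianalytic function of the angle. -/
theorem inDenjoyCarleman_chordIntegral {M : ℕ → ℝ} {C B : ℝ} {H : ℂ → ℂ}
    (hc : ContinuousOn H (Metric.closedBall 0 1))
    (hH : ∀ r ∈ Icc (0 : ℝ) 1,
      InDenjoyCarleman M C B fun θ : ℝ => H (r * Complex.exp (θ * Complex.I)))
    {z : ℝ} (hz : z ∈ Ioo (-1 : ℝ) 1) :
    InDenjoyCarleman M (C * (2 * √(1 - z ^ 2))) B (chordIntegral H z) := by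
  set s := √(1 - z ^ 2) with hs
  have hs0 : 0 ≤ s := Real.sqrt_nonneg _
  have hle : -s ≤ s := by linarith
  have key := InDenjoyCarleman.integral (M := M) (C := C) (B := B)
    (μ := volume.restrict (Ioc (-s) s))
    (K := fun (t θ : ℝ) => H (Complex.exp (θ * Complex.I) * (z + t * Complex.I)))
    (fun θ => ((continuousOn_chord hc hz θ).mono Ioc_subset_Icc_self).aestronglyMeasurable
      measurableSet_Ioc) ?_
  · have hvol : (volume.restrict (Ioc (-s) s)).real univ = 2 * s := by
      rw [measureReal_restrict_apply_univ, Real.volume_real_Ioc_of_le hle]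
      ring
    rw [hvol] at key
    convert key using 1
    exact funext fun θ => intervalIntegral.integral_of_le hle
  · refine (ae_restrict_iff' measurableSet_Ioc).2 (ae_of_all _ fun t ht => ?_)
    set w : ℂ := z + t * Complex.I with hw
    have hw1 : ‖w‖ ≤ 1 := by
      simpa using exp_mul_add_mul_I_mem_closedBall hz (Ioc_subset_Icc_self ht) 0
    -- Each point of the rotating chord moves on a circle of radius `‖w‖`; constants independent of
    -- the radius are what allows integration in `t`.
    convert (hH ‖w‖ ⟨norm_nonneg w, hw1⟩).comp_add_const w.arg using 3 with θ
    conv_lhs => rw [← Complex.norm_mul_exp_arg_mul_I w]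
    push_cast
    rw [add_mul, Complex.exp_add]
    ring

/-- A function on the disc which is uniformly quasianalytic in the angular variable vanishes if its
integrals over all broken rays with endpoints near a given boundary point do. -/
theorem eqOn_zero_of_sum_chordIntegral_eq_zero {M : ℕ → ℝ} (hM : IsQuasianalytic M) {C B : ℝ}
    (hC : 0 < C) (hB : 0 < B) {H : ℂ → ℂ} (hc : ContinuousOn H (Metric.closedBall 0 1))
    (hH : ∀ r ∈ Icc (0 : ℝ) 1,
      InDenjoyCarleman M C B fun θ : ℝ => H (r * Complex.exp (θ * Complex.I)))
    {A : Set ℝ} (hA : A ∈ 𝓝 (0 : ℝ)) (hAper : ∀ x ∈ A, ∀ k : ℤ, x + k * (2 * π) ∈ A)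
    (hsum : ∀ a ∈ Ioo 0 π, ∀ N : ℕ, 0 < N → ∀ θ ∈ A, θ + N * (2 * a) ∈ A →
      ∑ j ∈ Finset.range N, chordIntegral H (cos a) (θ + j * (2 * a) + a) = 0) :
    EqOn H 0 (Metric.closedBall 0 1) := by
  refine eqOn_zero_of_chordIntegral_eq_zero hc ?_
  -- Only countably many distances have periodic billiard orbits.
  filter_upwards [(countable_range fun q : ℚ => cos (q * π)).ae_notMem volume] with z hz hz1 θ
  set a := arccos z with ha
  have hcos : cos a = z := Real.cos_arccos hz1.1.le hz1.2.le
  have hirr : Irrational (2 * a / (2 * π)) := by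
    rintro ⟨q, hq⟩
    refine hz ⟨q, ?_⟩
    have : (q : ℝ) * π = a := by
      rw [hq]
      field_simp
    simp only [this, hcos]
  have ha0 : a ∈ Ioo 0 π := by
    refine ⟨Real.arccos_pos.2 hz1.2, lt_of_le_of_ne (Real.arccos_le_pi z) fun h => ?_⟩
    rw [h, Real.cos_pi] at hcos
    exact hz1.1.ne hcos
  have hpos : 0 < C * (2 * √(1 - z ^ 2)) := by
    have : 0 < √(1 - z ^ 2) := Real.sqrt_pos.2 (by nlinarith [hz1.1, hz1.2])
    positivity
  -- The shift by `a` passes from the starting angle of a chord to the angle of its normal.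
  have key := InDenjoyCarleman.eq_zero_of_orbit_sum_eq_zero hM hpos hB
    ((inDenjoyCarleman_chordIntegral hc hH hz1).comp_add_const a) hirr hA hAper
    (fun N hN θ hθ hθ' => hcos ▸ hsum a ha0 N hN θ hθ hθ') (θ - a)
  rwa [sub_add_cancel] at key

/-! ### Planar broken rays -/

/-- The isometric embedding of the complex plane as the plane with orthonormal basis `u, v`. -/
noncomputable def planeEmbedding {V : Type*} [NormedAddCommGroup V] [InnerProductSpace ℝ V]
    (u v : V)
    (huv : Orthonormal ℝ ![u, v]) : ℂ →ₗᵢ[ℝ] V where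
  toLinearMap := Complex.reLm.smulRight u + Complex.imLm.smulRight v
  norm_map' w := by
    have hu : ‖u‖ = 1 := huv.1 0
    have hv : ‖v‖ = 1 := huv.1 1
    have h01 : inner ℝ u v = 0 := huv.2 (i := 0) (j := 1) (by simp)
    rw [← sq_eq_sq₀ (norm_nonneg _) (norm_nonneg _), Complex.sq_norm, Complex.normSq_apply]
    simp [norm_add_sq_real, norm_smul, inner_smul_left, inner_smul_right, hu, hv, h01]
    ring

theorem planeEmbedding_apply {V : Type*} [NormedAddCommGroup V] [InnerProductSpace ℝ V] {u v : V}
    (huv : Orthonormal ℝ ![u, v]) (w : ℂ) :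
    planeEmbedding u v huv w = w.re • u + w.im • v := rfl

theorem exp_add_sub_exp_sub (φ a : ℝ) :
    Complex.exp ((φ + a : ℝ) * Complex.I) - Complex.exp ((φ - a : ℝ) * Complex.I) =
      (2 * sin a) • (Complex.I * Complex.exp (φ * Complex.I)) := by
  simp only [Complex.ofReal_add, Complex.ofReal_sub, Complex.exp_mul_I, Complex.real_smul,
    Complex.cos_add, Complex.cos_sub, Complex.sin_add, Complex.sin_sub]
  push_cast
  ring_nf
  simp only [Complex.I_sq]
  ring

theorem inner_exp_I_mul_exp_sub (ψ a : ℝ) :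
    inner ℝ (Complex.exp (ψ * Complex.I)) (Complex.I * Complex.exp ((ψ - a : ℝ) * Complex.I)) =
      sin a := by
  rw [Complex.inner]
  simp only [Complex.mul_re, Complex.mul_im, Complex.conj_re, Complex.conj_im, Complex.I_re,
    Complex.I_im, Complex.exp_ofReal_mul_I_re, Complex.exp_ofReal_mul_I_im, cos_sub, sin_sub]
  linear_combination sin a * sin_sq_add_cos_sq ψ

/-- The law of reflection at angle `ψ`: the incoming and outgoing chords have normals at `ψ - a` and
`ψ + a`, and `sin a` is the normal component of the incoming direction. -/
theorem I_mul_exp_add (ψ a : ℝ) :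
    Complex.I * Complex.exp ((ψ + a : ℝ) * Complex.I) =
      Complex.I * Complex.exp ((ψ - a : ℝ) * Complex.I) -
        (2 * sin a) • Complex.exp (ψ * Complex.I) := by
  have h := exp_add_sub_exp_sub ψ a
  rw [sub_eq_iff_eq_add] at h
  rw [h, Complex.real_smul, Complex.real_smul]
  linear_combination ((2 * sin a : ℝ) : ℂ) * Complex.exp (ψ * Complex.I) * Complex.I_sq

section Plane

variable {n : ℕ} {u v : EuclideanSpace ℝ (Fin n)} (huv : Orthonormal ℝ ![u, v])

/-- The point at angle `θ` of the unit circle of the plane with orthonormal basis `u, v`. -/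
noncomputable def circlePoint (θ : ℝ) : Metric.sphere (0 : EuclideanSpace ℝ (Fin n)) 1 :=
  ⟨planeEmbedding u v huv (Complex.exp (θ * Complex.I)), by
    rw [mem_sphere_zero_iff_norm, LinearIsometry.norm_map, Complex.norm_exp_ofReal_mul_I]⟩

theorem continuous_circlePoint : Continuous (circlePoint huv) :=
  ((planeEmbedding u v huv).continuous.comp (by fun_prop)).subtype_mk _

theorem circlePoint_add_int_mul_two_pi (θ : ℝ) (k : ℤ) :
    circlePoint huv (θ + k * (2 * π)) = circlePoint huv θ := by
  refine Subtype.ext (congrArg (planeEmbedding u v huv) ?_)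
  have h : ((θ + k * (2 * π) : ℝ) : ℂ) * Complex.I =
      θ * Complex.I + k * (2 * π * Complex.I) := by
    push_cast
    ring
  rw [h, Complex.exp_periodic.int_mul k]

theorem circlePoint_add_sub_circlePoint_sub (φ a : ℝ) :
    (circlePoint huv (φ + a) : EuclideanSpace ℝ (Fin n)) - circlePoint huv (φ - a) =
      (2 * sin a) • planeEmbedding u v huv (Complex.I * Complex.exp (φ * Complex.I)) := by
  rw [← map_smul, ← exp_add_sub_exp_sub, map_sub]
  rfl

theorem norm_planeEmbedding_I_mul_exp (φ : ℝ) :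
    ‖planeEmbedding u v huv (Complex.I * Complex.exp (φ * Complex.I))‖ = 1 := by
  rw [LinearIsometry.norm_map, norm_mul, Complex.norm_I, Complex.norm_exp_ofReal_mul_I, one_mul]

theorem norm_circlePoint_add_sub_circlePoint_sub (φ : ℝ) {a : ℝ} (ha : 0 < sin a) :
    ‖(circlePoint huv (φ + a) : EuclideanSpace ℝ (Fin n)) - circlePoint huv (φ - a)‖ =
      2 * sin a := by
  rw [circlePoint_add_sub_circlePoint_sub, norm_smul, norm_planeEmbedding_I_mul_exp, mul_one,
    Real.norm_of_nonneg (by positivity)]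

theorem direction_circlePoint_sub_circlePoint_add (φ : ℝ) {a : ℝ} (ha : 0 < sin a) :
    direction (circlePoint huv (φ - a) : EuclideanSpace ℝ (Fin n)) (circlePoint huv (φ + a)) =
      planeEmbedding u v huv (Complex.I * Complex.exp (φ * Complex.I)) := by
  rw [direction, norm_circlePoint_add_sub_circlePoint_sub huv φ ha,
    circlePoint_add_sub_circlePoint_sub, inv_smul_smul₀ (by positivity)]

variable {E : Set (Metric.sphere (0 : EuclideanSpace ℝ (Fin n)) 1)}

/-- The broken ray in the plane with orthonormal basis `u, v` with `N` segments, starting at the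
angle `θ` and turning by the angle `2 * a` with every segment. -/
noncomputable def planarBrokenRay {θ a : ℝ} (ha : 0 < sin a) {N : ℕ} (hN : 0 < N)
    (h0 : circlePoint huv θ ∈ E) (h1 : circlePoint huv (θ + N * (2 * a)) ∈ E) : BrokenRay E where
  N := N
  N_pos := hN
  vertex j := circlePoint huv (θ + j * (2 * a))
  start_mem := by simpa using h0
  end_mem := h1
  vertex_ne j _ h := by
    have := norm_circlePoint_add_sub_circlePoint_sub huv (θ + j * (2 * a) + a) ha
    rw [add_sub_cancel_right, h, add_assoc _ a a] at this
    push_cast at this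
    rw [show θ + (j + 1) * (2 * a) = θ + j * (2 * a) + (a + a) by ring, sub_self, norm_zero] at this
    linarith
  reflection j _ := by
    -- The angle of the vertex where the reflection takes place.
    set ψ := θ + (j + 1 : ℕ) * (2 * a) with hψ
    have e0 : θ + j * (2 * a) = ψ - a - a := by rw [hψ]; push_cast; ring
    have e2 : θ + (j + 2 : ℕ) * (2 * a) = ψ + a + a := by rw [hψ]; push_cast; ring
    have d1 := direction_circlePoint_sub_circlePoint_add huv (ψ - a) ha
    have d2 := direction_circlePoint_sub_circlePoint_add huv (ψ + a) ha
    rw [sub_add_cancel] at d1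
    rw [add_sub_cancel_right] at d2
    rw [e0, e2, d1, d2, I_mul_exp_add, map_sub, map_smul, ← inner_exp_I_mul_exp_sub ψ a,
      ← (planeEmbedding u v huv).inner_map_map]
    rfl

theorem brokenRayTransform_planarBrokenRay (f : EuclideanSpace ℝ (Fin n) → ℂ) {θ a : ℝ}
    (ha : 0 < sin a) {N : ℕ} (hN : 0 < N) (h0 : circlePoint huv θ ∈ E)
    (h1 : circlePoint huv (θ + N * (2 * a)) ∈ E) :
    brokenRayTransform E f (planarBrokenRay huv ha hN h0 h1) =
      ∑ j ∈ Finset.range N,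
        chordIntegral (f ∘ planeEmbedding u v huv) (cos a) (θ + j * (2 * a) + a) := by
  refine Finset.sum_congr rfl fun j _ => ?_
  simp only [planarBrokenRay]
  set φ := θ + j * (2 * a) + a with hφ
  have e0 : θ + j * (2 * a) = φ - a := by rw [hφ]; ring
  have e1 : θ + (j + 1 : ℕ) * (2 * a) = φ + a := by rw [hφ]; push_cast; ring
  have hsqrt : √(1 - cos a ^ 2) = sin a := by
    rw [← Real.sin_sq, Real.sqrt_sq ha.le]
  -- The transform measures arc length from the initial vertex, `chordIntegral` from the midpoint;
  -- the two differ by `sin a`.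
  have hint := intervalIntegral.integral_comp_sub_right (a := 0) (b := 2 * sin a)
    (fun t : ℝ => (f ∘ planeEmbedding u v huv)
      (Complex.exp (φ * Complex.I) * (cos a + t * Complex.I))) (sin a)
  rw [zero_sub, show 2 * sin a - sin a = sin a by ring] at hint
  rw [e0, e1, norm_circlePoint_add_sub_circlePoint_sub huv φ ha,
    direction_circlePoint_sub_circlePoint_add huv φ ha, chordIntegral, hsqrt, ← hint]
  refine intervalIntegral.integral_congr fun s _ => congrArg f ?_
  change planeEmbedding u v huv _ + _ = _
  rw [← map_smul, ← map_add]
  refine congrArg (planeEmbedding u v huv) ?_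
  have h : Complex.exp ((φ - a : ℝ) * Complex.I) =
      Complex.exp (φ * Complex.I) * (cos a - sin a * Complex.I) := by
    rw [Complex.ofReal_sub, sub_mul, sub_eq_add_neg, Complex.exp_add, ← neg_mul,
      Complex.exp_mul_I (-(a : ℂ)), Complex.cos_neg, Complex.sin_neg, neg_mul, ← sub_eq_add_neg,
      Complex.ofReal_cos, Complex.ofReal_sin]
  rw [h, Complex.real_smul]
  push_cast
  ring

/-- Two functions with the same broken ray transform agree on the disc in a plane through the origin
which contains a point of the set of tomography. -/
theorem eq_planeEmbedding_of_brokenRayTransform_eq (hEopen : IsOpen E)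
    (hE : circlePoint huv 0 ∈ E) {M : ℕ → ℝ} {f g : EuclideanSpace ℝ (Fin n) → ℂ}
    (hfc : ContinuousOn f (Metric.closedBall 0 1)) (hgc : ContinuousOn g (Metric.closedBall 0 1))
    (hfq : UniformlyQuasianalytic M f u v) (hgq : UniformlyQuasianalytic M g u v)
    (hfg : brokenRayTransform E f = brokenRayTransform E g) {w : ℂ} (hw : ‖w‖ ≤ 1) :
    f (planeEmbedding u v huv w) = g (planeEmbedding u v huv w) := by
  obtain ⟨hM, C, B, hC, hB, hf⟩ := hfq
  obtain ⟨-, C', B', hC', hB', hg⟩ := hgq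
  set ι := planeEmbedding u v huv with hι
  have hmaps : MapsTo ι (Metric.closedBall 0 1) (Metric.closedBall 0 1) := fun z hz => by
    rwa [mem_closedBall_zero_iff, ι.norm_map, ← mem_closedBall_zero_iff]
  have hfc' := hfc.comp ι.continuous.continuousOn hmaps
  have hgc' := hgc.comp ι.continuous.continuousOn hmaps
  have hprof : ∀ (f : EuclideanSpace ℝ (Fin n) → ℂ) (r θ : ℝ),
      angularProfile f u v r θ = (f ∘ ι) (r * Complex.exp (θ * Complex.I)) := fun f r θ => by
    rw [Function.comp_apply, ← Complex.real_smul, map_smul, hι, planeEmbedding_apply,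
      Complex.exp_ofReal_mul_I_re, Complex.exp_ofReal_mul_I_im]
    rfl
  have key : EqOn (f ∘ ι - g ∘ ι) 0 (Metric.closedBall 0 1) := by
    refine eqOn_zero_of_sum_chordIntegral_eq_zero hM (add_pos hC hC') (lt_max_of_lt_left (c := B') hB)
      (hfc'.sub hgc') (fun r hr => ?_) (A := circlePoint huv ⁻¹' E)
      ((hEopen.preimage (continuous_circlePoint huv)).mem_nhds hE)
      (fun x hx k => ?_) (fun a ha N hN θ h0 h1 => ?_)
    · convert InDenjoyCarleman.sub hM.1 hC.le hC'.le hB.le hB'.le (hf r hr) (hg r hr) using 1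
      exact funext fun θ => by simp only [Pi.sub_apply, hprof]
    · rwa [mem_preimage, circlePoint_add_int_mul_two_pi]
    · have hsin := Real.sin_pos_of_mem_Ioo ha
      have hcos : cos a ∈ Ioo (-1 : ℝ) 1 := by
        have := Real.sin_sq_add_cos_sq a
        rw [mem_Ioo, ← abs_lt, ← sq_lt_one_iff_abs_lt_one]
        nlinarith
      have h := congrFun hfg (planarBrokenRay huv hsin hN h0 h1)
      rw [brokenRayTransform_planarBrokenRay, brokenRayTransform_planarBrokenRay, ← sub_eq_zero,
        ← Finset.sum_sub_distrib] at h
      rw [← h]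
      exact Finset.sum_congr rfl fun j _ => chordIntegral_sub hfc' hgc' hcos _
  exact sub_eq_zero.1 (key (mem_closedBall_zero_iff.2 hw))

end Plane

/-! ### Choice of the plane and conclusion -/

/-- In dimension at least two, every point lies in a plane containing a given unit vector. -/
theorem exists_orthonormal_pair_mem_range {n : ℕ} (hn : 2 ≤ n) {e : EuclideanSpace ℝ (Fin n)}
    (he : ‖e‖ = 1) (x : EuclideanSpace ℝ (Fin n)) :
    ∃ (v : EuclideanSpace ℝ (Fin n)) (hev : Orthonormal ℝ ![e, v]) (w : ℂ),
      planeEmbedding e v hev w = x := by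
  have horth : ∀ v : EuclideanSpace ℝ (Fin n), ‖v‖ = 1 → inner ℝ e v = 0 →
      Orthonormal ℝ ![e, v] := fun v hv h => by
    refine ⟨fun i => ?_, fun i j hij => ?_⟩
    · fin_cases i <;> simp [he, hv]
    · fin_cases i <;> fin_cases j <;> simp_all [real_inner_comm]
  set y := x - inner ℝ e x • e with hy
  have hey : inner ℝ e y = 0 := by
    rw [hy, inner_sub_right, inner_smul_right, real_inner_self_eq_norm_sq, he]
    ring
  -- If `x` lies on the line of `e`, any unit vector orthogonal to `e` serves; one exists because `n
  -- ≥ 2`.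
  by_cases h0 : y = 0
  · have hfin : 0 < Module.finrank ℝ (ℝ ∙ e)ᗮ := by
      have h1 := (ℝ ∙ e).finrank_add_finrank_orthogonal
      have h2 := finrank_span_singleton (K := ℝ) (v := e) (by
        rintro rfl
        simp at he)
      rw [finrank_euclideanSpace_fin] at h1
      omega
    have := Module.finrank_pos_iff.1 hfin
    obtain ⟨v, hv⟩ := exists_norm_eq (ℝ ∙ e)ᗮ zero_le_one
    have hev := Submodule.mem_orthogonal_singleton_iff_inner_right.1 v.2
    refine ⟨v, horth v hv hev, ((inner ℝ e x : ℝ) : ℂ), ?_⟩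
    rw [planeEmbedding_apply, Complex.ofReal_re, Complex.ofReal_im, zero_smul, add_zero]
    exact (sub_eq_zero.1 h0).symm
  · have hy0 : ‖y‖ ≠ 0 := norm_ne_zero_iff.2 h0
    refine ⟨‖y‖⁻¹ • y, horth _ ?_ ?_, ⟨inner ℝ e x, ‖y‖⟩, ?_⟩
    · rw [norm_smul, norm_inv, norm_norm, inv_mul_cancel₀ hy0]
    · rw [inner_smul_right, hey, mul_zero]
    · rw [planeEmbedding_apply, smul_inv_smul₀ hy0, hy, add_sub_cancel]

theorem mainTheorem2 (n : ℕ) (hn : 2 ≤ n)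
    (E : Set (Metric.sphere (0 : EuclideanSpace ℝ (Fin n)) 1))
    (hEopen : IsOpen E) (hEne : E.Nonempty)
    (M : EuclideanSpace ℝ (Fin n) → EuclideanSpace ℝ (Fin n) → ℕ → ℝ)
    (f g : EuclideanSpace ℝ (Fin n) → ℂ)
    (hfc : ContinuousOn f (Metric.closedBall 0 1))
    (hgc : ContinuousOn g (Metric.closedBall 0 1))
    (hfq : ∀ u v, Orthonormal ℝ ![u, v] → UniformlyQuasianalytic (M u v) f u v)
    (hgq : ∀ u v, Orthonormal ℝ ![u, v] → UniformlyQuasianalytic (M u v) g u v)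
    (hfd : ∀ u v, Orthonormal ℝ ![u, v] → ∀ l, AngularDiniLipschitz f u v l)
    (hgd : ∀ u v, Orthonormal ℝ ![u, v] → ∀ l, AngularDiniLipschitz g u v l)
    (hfg : brokenRayTransform E f = brokenRayTransform E g) :
    EqOn f g (Metric.closedBall 0 1) := by
  intro x hx
  obtain ⟨e, he⟩ := hEne
  obtain ⟨v, hev, w, rfl⟩ :=
    exists_orthonormal_pair_mem_range hn (mem_sphere_zero_iff_norm.1 e.2) x
  rw [mem_closedBall_zero_iff, LinearIsometry.norm_map] at hx
  have he0 : circlePoint hev 0 = e := Subtype.ext (by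
    change planeEmbedding _ v hev _ = _
    simp [planeEmbedding_apply])
  exact eq_planeEmbedding_of_brokenRayTransform_eq hev hEopen (by rwa [he0]) hfc hgc
    (hfq _ v hev) (hgq _ v hev) hfg hx
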